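/- Consider a sequence of multiserver-job systems indexed by the number of servers $n$, with a fixed number $I$ of job types. In the $n$-th system, type $i$ jobs arrive according to a Poisson process of rate $\lambda_i=\lambda_i^{(n)}$. Each of them needs the simultaneous service of $\ell_i=\ell_i^{(n)}\ge 1$ servers and has an exponentially distributed service time with rate $\mu_i>0$, where $I$ and the $\mu_i$ do not depend on $n$; arrivals and service times are independent. A scheduling policy (possibly preemptive) decides at any time which jobs are in service, the jobs in service never needing more than $n$ servers in total; the system under the policy is a continuous-time Markov chain with countable state space and bounded transition rates. Let $X_i$ and $Z_i$ denote the numbers of type $i$ jobs in the system and in service, $\ell_{\max}=\max_i\ell_i$ and $\delta=n-\sum_{i=1}^I\lambda_i\ell_i/\mu_i$. The policy is $\ell_{\max}$-work-conserving if at all times $\sum_i\ell_iZ_i\ge\min\left(\sum_i\ell_iX_i,\;n-\ell_{\max}\right)$. Suppose that, for some constant $\epsilon_0\in(0,1)$, $\ell_{\max}\le\epsilon_0\delta$ for all large $n$, and that $\delta=\omega\left(\sqrt{n\ell_{\max}}\,\log n\right)$ as $n\to\infty$. Then there is a constant $c>0$, depending only on $I$, the $\mu_i$ and $\epsilon_0$,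 such that for all sufficiently large $n$, under every $\ell_{\max}$-work-conserving policy and for every stationary distribution of the system, with $X_i(\infty)$ the steady-state number of type $i$ jobs, $$\mathbb{P}\left(\sum_{i=1}^I\ell_iX_i(\infty)\ge n\right)\le\exp\left(-c\,\frac{\delta^2}{n\ell_{\max}}\right),$$ that is, this probability is $\exp\left(-\Omega\left(\frac{\delta^2}{n\ell_{\max}}\right)\right)$; and the queueing probability, i.e. the probability that a job arriving in steady state has to queue rather than entering service immediately, satisfies the same bound. -/

import Mathlib

open Filter Asymptotics
open scoped NNReal ENNReal

noncomputable section

namespace MSJ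

/-- A snapshot of the jobs present in the system, listed in their order of arrival.
Each entry records the type of the job and whether the job is currently in service. -/
abbrev JobList (I : ℕ) : Type := List (Fin I × Bool)

/-- The types of the jobs present, in the order of arrival. -/
def types {I : ℕ} (u : JobList I) : List (Fin I) := u.map Prod.fst

/-- `X_i`: the number of type `i` jobs in the system. -/
def numInSystem {I : ℕ} (u : JobList I) (i : Fin I) : ℕ := (types u).count i

/-- `Z_i`: the number of type `i` jobs in service. -/
def numInService {I : ℕ} (u : JobList I) (i : Fin I) : ℕ := u.count (i, true)

/-- The total server need `∑ ℓ_i X_i`. -/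
def totalNeed {I : ℕ} (ell : Fin I → ℕ) (u : JobList I) : ℕ := ∑ i, ell i * numInSystem u i

/-- The number of busy servers `∑ ℓ_i Z_i`. -/
def busyServers {I : ℕ} (ell : Fin I → ℕ) (u : JobList I) : ℕ := ∑ i, ell i * numInService u i

/-- The most recently arrived job of the list exists and is waiting in the queue. -/
def NewestIsQueued {I : ℕ} (u : JobList I) : Prop := ∃ i : Fin I, u.getLast? = some (i, false)

/-- A (Markovian, possibly preemptive, possibly randomized) scheduling policy for `n` servers and
`I` job types with server needs `ell`. The policy keeps a state in a countable set, which determines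
the ordered list of jobs present together with the choice of the jobs in service, and which may hold
any further information that the policy uses. At each arrival and each service completion
the policy moves, possibly at random, to a new state; it may also revise its decision at the ticks
of an independent Poisson clock of rate `clock` (`clock = 0` if it does not). -/
structure Policy (I n : ℕ) (ell : Fin I → ℕ) where
  State : Type
  countable_state : Countable State
  jobs : State → JobList I
  /-- the jobs in service never need more than `n` servers -/
  feasible : ∀ s, busyServers ell (jobs s) ≤ n
  /-- the new state after the arrival of a job of type `i` -/
  arrive : State → Fin I → PMF State
  arrive_types : ∀ s i, ∀ s' ∈ (arrive s i).support,
    types (jobs s') = types (jobs s) ++ [i]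
  /-- the new state after the service completion of the `k`-th job
  (used only if that job is in service) -/
  complete : (s : State) → Fin (jobs s).length → PMF State
  complete_types : ∀ s k, ((jobs s).get k).2 = true → ∀ s' ∈ (complete s k).support,
    types (jobs s') = (types (jobs s)).eraseIdx k
  clock : ℝ≥0
  /-- the new state after a tick of the policy's own clock -/
  review : State → PMF State
  review_types : ∀ s, ∀ s' ∈ (review s).support, types (jobs s') = types (jobs s)

namespace Policy

variable {I n : ℕ} {ell : Fin I → ℕ}

/-- `w`-work-conserving: `∑ ℓ_i Z_i ≥ min (∑ ℓ_i X_i) (n - w)` at all times. -/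
def IsWorkConserving (P : Policy I n ell) (w : ℝ) : Prop :=
  ∀ s, min (totalNeed ell (P.jobs s) : ℝ) ((n : ℝ) - w) ≤ (busyServers ell (P.jobs s) : ℝ)

/-- The transition rate from `s` to `s'` of the continuous-time Markov chain of the system: type `i`
jobs arrive at rate `lam i`, and every type `i` job in service completes at rate `mu i`. -/
def rate (P : Policy I n ell) (lam mu : Fin I → ℝ≥0) (s s' : P.State) : ℝ≥0∞ :=
  (∑ i, (lam i : ℝ≥0∞) * P.arrive s i s')
    + (∑ k : Fin (P.jobs s).length,
        if ((P.jobs s).get k).2 = true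
          then (mu ((P.jobs s).get k).1 : ℝ≥0∞) * P.complete s k s' else 0)
    + (P.clock : ℝ≥0∞) * P.review s s'

/-- `π` is a stationary distribution of the chain: in every state the probability flow in equals the
flow out. (The total transition rates are bounded over the states, so the chain does not explode.
A transition from a state to itself contributes the same finite amount to both sides.) -/
def IsStationary (P : Policy I n ell) (lam mu : Fin I → ℝ≥0) (π : PMF P.State) : Prop :=
  ∀ s', ∑' s, π s * P.rate lam mu s s' = π s' * ∑' s, P.rate lam mu s' s

/-- The probability that the total server need is at least `n` when the state has law `π`. -/
def probNeedGe (P : Policy I n ell) (π : PMF P.State) : ℝ≥0∞ :=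
  π.toOuterMeasure {s | n ≤ totalNeed ell (P.jobs s)}

/-- The queueing probability: a job that arrives while the state has law `π`, and which is of type
`i` with probability `lam i / ∑ j, lam j`, is put into the queue upon its arrival. -/
def queueingProb (P : Policy I n ell) (lam : Fin I → ℝ≥0) (π : PMF P.State) : ℝ≥0∞ :=
  ∑ i, ((lam i : ℝ≥0∞) / ∑ j, (lam j : ℝ≥0∞)) *
    (π.bind fun s => P.arrive s i).toOuterMeasure {s' | NewestIsQueued (P.jobs s')}

end Policy

/-- The maximal server need `ℓ_max`. -/
def maxNeed {I : ℕ} (ell : Fin I → ℕ) : ℕ := Finset.univ.sup ell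

/-- The slack capacity `δ = n - ∑ λ_i ℓ_i / μ_i`. -/
def slack {I : ℕ} (n : ℕ) (lam mu : Fin I → ℝ≥0) (ell : Fin I → ℕ) : ℝ :=
  (n : ℝ) - ∑ i, (lam i : ℝ) * (ell i : ℝ) / (mu i : ℝ)

end MSJ

end

/-! Fix `n`, and write `w` for the largest need and `D` for the slack. The proof is an exponential
Foster–Lyapunov argument for `excess`. The weight `1 / mu i` turns the drift of type `i` into its
load minus its busy servers, so work conservation, which controls only the total of busy servers,
suffices. Positive parts keep types below equilibrium from cancelling the excess of the others;
smoothing at scale `h` makes the second-order cost of a jump small. If all needs are served, the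
drift is at most `-m * excess`; if at least `n - w` servers are busy, it is at most `-(d - I * h)`,
where `d ≤ D - w` (`le_sum_ramp_mul`). With `θ` of order `D / (n * w)` the second-order terms stay
below half of this drift (`exp_excess_drift`), and stationarity bounds the mean of `exp (θ *
excess)` (`mul_tsum_le_of_drift`). A need of at least `n - w` forces `excess` to be of order `D`
(`le_excess`), so Markov's inequality gives `exp (-c * D ^ 2 / (n * w))`. Both events of the theorem
reduce to this one; for queueing this is `queueingProb_le`. -/

namespace MSJ

/-! ### The smoothed positive part -/

/-- The derivative of `huber`: a ramp from `0` to `1` on the interval `[0, h]`. -/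
noncomputable def ramp (h y : ℝ) : ℝ := max 0 (min 1 (y / h))

/-- A smoothed positive part: `0` for `y ≤ 0`, quadratic on `[0, h]`, and `y - h / 2` beyond. -/
noncomputable def huber (h y : ℝ) : ℝ := ramp h y * y - ramp h y ^ 2 * h / 2

lemma ramp_nonneg (h y : ℝ) : 0 ≤ ramp h y := le_max_left _ _

lemma ramp_le_one (h y : ℝ) : ramp h y ≤ 1 := max_le zero_le_one (min_le_left _ _)

lemma abs_ramp_sub_le {h : ℝ} (hh : 0 < h) (y z : ℝ) : |ramp h z - ramp h y| ≤ |z - y| / h := by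
  have h1 : |ramp h z - ramp h y| ≤ |z / h - y / h| := by
    unfold ramp
    refine (abs_max_sub_max_le_max _ _ _ _).trans ?_
    rw [sub_self, abs_zero, max_eq_right (abs_nonneg _)]
    refine (abs_min_sub_min_le_max _ _ _ _).trans ?_
    rw [sub_self, abs_zero, max_eq_right (abs_nonneg _)]
  rwa [← sub_div, abs_div, abs_of_pos hh] at h1

/-- `huber h` is the maximum of these lines over slopes `p` in `[0, 1]`, attained at `p = ramp h y`.
Nonnegativity (`p = 0`), the bound `y - h / 2` (`p = 1`) and convexity all follow. -/
lemma le_huber {h : ℝ} (hh : 0 < h) (y : ℝ) {p : ℝ} (hp0 : 0 ≤ p) (hp1 : p ≤ 1) :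
    p * y - p ^ 2 * h / 2 ≤ huber h y := by
  obtain ⟨t, rfl⟩ : ∃ t, y = t * h := ⟨y / h, by field_simp⟩
  unfold huber ramp
  rw [mul_div_cancel_right₀ _ hh.ne']
  suffices H : p * t - p ^ 2 / 2 ≤ max 0 (min 1 t) * t - max 0 (min 1 t) ^ 2 / 2 by
    nlinarith
  rcases le_total t 0 with h0 | h0
  · rw [max_eq_left ((min_le_right _ _).trans h0)]
    nlinarith
  · rcases le_total t 1 with h1 | h1
    · rw [min_eq_right h1, max_eq_right h0]
      nlinarith [sq_nonneg (p - t)]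
    · rw [min_eq_left h1, max_eq_right zero_le_one]
      nlinarith

lemma huber_nonneg {h : ℝ} (hh : 0 < h) (y : ℝ) : 0 ≤ huber h y := by
  simpa using le_huber hh y le_rfl zero_le_one

lemma huber_le_ramp_mul {h : ℝ} (hh : 0 < h) (y : ℝ) : huber h y ≤ ramp h y * y := by
  unfold huber
  have := mul_nonneg (sq_nonneg (ramp h y)) hh.le
  linarith

lemma ramp_mul_sub_le_huber_sub {h : ℝ} (hh : 0 < h) (y z : ℝ) :
    ramp h y * (z - y) ≤ huber h z - huber h y := by
  have := le_huber hh z (ramp_nonneg h y) (ramp_le_one h y)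
  unfold huber at *
  linarith

/-- The subgradient inequality at `z` bounds the increment by `ramp h z * (z - y)`; moving the slope
back to `y` costs its Lipschitz constant `1 / h`. -/
lemma huber_sub_le {h : ℝ} (hh : 0 < h) (y z : ℝ) :
    huber h z - huber h y ≤ ramp h y * (z - y) + (z - y) ^ 2 / h := by
  have h1 := ramp_mul_sub_le_huber_sub hh z y
  have h2 : (ramp h z - ramp h y) * (z - y) ≤ (z - y) ^ 2 / h := by
    calc (ramp h z - ramp h y) * (z - y) ≤ |ramp h z - ramp h y| * |z - y| := by
          rw [← abs_mul]; exact le_abs_self _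
      _ ≤ |z - y| / h * |z - y| := by
          gcongr; exact abs_ramp_sub_le hh y z
      _ = (z - y) ^ 2 / h := by rw [← sq_abs]; ring
  linarith

lemma abs_huber_sub_le {h : ℝ} (hh : 0 < h) (y z : ℝ) : |huber h z - huber h y| ≤ |z - y| := by
  have key : ∀ a b : ℝ, -|b - a| ≤ huber h b - huber h a := fun a b => by
    refine le_trans ?_ (ramp_mul_sub_le_huber_sub hh a b)
    have h1 : |ramp h a * (b - a)| ≤ |b - a| := by
      rw [abs_mul, abs_of_nonneg (ramp_nonneg h a)]
      exact mul_le_of_le_one_left (abs_nonneg _) (ramp_le_one h a)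
    exact (neg_le_neg h1).trans (neg_abs_le _)
  have h1 := key y z
  have h2 := key z y
  rw [abs_sub_comm] at h2
  exact abs_le.2 ⟨h1, by linarith⟩

/-- Bounds the cost, per type, of replacing a ramp by `1` in the drift. -/
lemma one_sub_ramp_mul_le {h : ℝ} (hh : 0 < h) (y : ℝ) : (1 - ramp h y) * y ≤ h := by
  have h1 := ramp_le_one h y
  have h0 := ramp_nonneg h y
  rcases le_total y h with hy | hy
  · nlinarith
  · have : ramp h y = 1 := by
      unfold ramp
      rw [min_eq_left ((one_le_div hh).2 hy), max_eq_right zero_le_one]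
    rw [this]; linarith

/-! ### The Lyapunov function and its drift -/

/-- The Lyapunov function: a weighted sum of the smoothed excesses of the server needs `ell i * x i`
over their equilibrium values `lam i * ell i / mu i`. -/
noncomputable def excess {I : ℕ} (h : ℝ) (lam mu ell x : Fin I → ℝ) : ℝ :=
  ∑ i, huber h (ell i * x i - lam i * ell i / mu i) / mu i

section Drift

variable {I : ℕ} {h m L : ℝ} {lam mu ell x z : Fin I → ℝ}

lemma excess_update (i : Fin I) (a : ℝ) :
    excess h lam mu ell (Function.update x i a) = excess h lam mu ell x +
      (huber h (ell i * a - lam i * ell i / mu i)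
        - huber h (ell i * x i - lam i * ell i / mu i)) / mu i := by
  have key : ∀ x : Fin I → ℝ, excess h lam mu ell x
      = huber h (ell i * x i - lam i * ell i / mu i) / mu i
        + ∑ j ∈ Finset.univ.erase i, huber h (ell j * x j - lam j * ell j / mu j) / mu j :=
    fun x => (Finset.add_sum_erase _ _ (Finset.mem_univ i)).symm
  rw [key x, key, Function.update_self]
  have : ∑ j ∈ Finset.univ.erase i,
        huber h (ell j * Function.update x i a j - lam j * ell j / mu j) / mu j
      = ∑ j ∈ Finset.univ.erase i, huber h (ell j * x j - lam j * ell j / mu j) / mu j :=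
    Finset.sum_congr rfl fun j hj => by rw [Function.update_of_ne (Finset.ne_of_mem_erase hj)]
  rw [this]; ring

/-- One jump of the exponential Lyapunov function, to second order. -/
lemma exp_excess_update_le {θ a w : ℝ} (hh : 0 < h) (hm : 0 < m) (hmu : ∀ i, m ≤ mu i)
    (hell : ∀ i, 0 ≤ ell i) (hθ : 0 ≤ θ) (hw : ∀ i, ell i ≤ w) (hw1 : θ * w / m ≤ 1) (i : Fin I)
    (ha : |a - x i| = 1) :
    Real.exp (θ * excess h lam mu ell (Function.update x i a)) ≤
      Real.exp (θ * excess h lam mu ell x) *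
        (1 + (θ * (ramp h (ell i * x i - lam i * ell i / mu i) * (a - x i) + w / h)
          + θ ^ 2 * (w / m)) * (ell i / mu i)) := by
  have hmui : 0 < mu i := hm.trans_le (hmu i)
  set y := ell i * x i - lam i * ell i / mu i
  set y' := ell i * a - lam i * ell i / mu i
  have hyy : y' - y = ell i * (a - x i) := by simp only [y, y']; ring
  have habs : |y' - y| = ell i := by rw [hyy, abs_mul, ha, mul_one, abs_of_nonneg (hell i)]
  have hsq : (y' - y) ^ 2 = ell i ^ 2 := by rw [← sq_abs, habs]
  set t := θ * ((huber h y' - huber h y) / mu i)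
  have h1 : huber h y' - huber h y ≤ ell i * (ramp h y * (a - x i) + w / h) := by
    have := huber_sub_le hh y y'
    rw [hsq, hyy] at this
    have h2 : ell i ^ 2 / h ≤ ell i * (w / h) := by
      rw [sq, mul_div_assoc]
      exact mul_le_mul_of_nonneg_left (div_le_div_of_nonneg_right (hw i) hh.le) (hell i)
    linarith
  have h3 : |t| ≤ θ * (ell i / mu i) := by
    simp only [t]
    rw [abs_mul, abs_div, abs_of_nonneg hθ, abs_of_pos hmui]
    gcongr
    exact (abs_huber_sub_le hh y y').trans habs.le
  have h4 : ell i / mu i ≤ w / m := by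
    have := (hell i).trans (hw i)
    gcongr
    · exact hw i
    · exact hmu i
  have h5 : |t| ≤ 1 := by
    refine h3.trans (le_trans ?_ hw1)
    rw [mul_div_assoc]; gcongr
  have h6 : t ^ 2 ≤ θ ^ 2 * (w / m) * (ell i / mu i) := by
    have h0 : 0 ≤ ell i / mu i := div_nonneg (hell i) hmui.le
    calc t ^ 2 = |t| ^ 2 := (sq_abs t).symm
      _ ≤ (θ * (ell i / mu i)) ^ 2 := by gcongr
      _ = θ ^ 2 * ((ell i / mu i) * (ell i / mu i)) := by ring
      _ ≤ θ ^ 2 * ((w / m) * (ell i / mu i)) := by gcongr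
      _ = _ := by ring
  have h7 : t ≤ θ * (ramp h y * (a - x i) + w / h) * (ell i / mu i) := by
    calc t ≤ θ * (ell i * (ramp h y * (a - x i) + w / h) / mu i) := by
          simp only [t]; gcongr
      _ = _ := by ring
  rw [excess_update, mul_add, Real.exp_add]
  gcongr
  -- The hypothesis `θ * w / m ≤ 1` serves to reach `|t| ≤ 1`, where `exp t ≤ 1 + t + t ^ 2`.
  have h8 := (abs_le.1 (Real.abs_exp_sub_one_sub_id_le h5)).2
  change Real.exp t ≤ _
  linarith

/-- The first order drift under a work-conserving allocation `z` of servers. -/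
lemma le_sum_ramp_mul {n w d : ℝ} (hh : 0 < h) (hm : 0 < m) (hmu : ∀ i, m ≤ mu i)
    (hell : ∀ i, 0 ≤ ell i) (hzx : ∀ i, z i ≤ x i)
    (hd : d ≤ n - ∑ i, lam i * ell i / mu i - w)
    (hwc : min (∑ i, ell i * x i) (n - w) ≤ ∑ i, ell i * z i) :
    min (m * excess h lam mu ell x) (d - I * h) ≤
      ∑ i, ramp h (ell i * x i - lam i * ell i / mu i) * (ell i * z i - lam i * ell i / mu i) := by
  have hle : ∀ i, ell i * z i ≤ ell i * x i :=
    fun i => mul_le_mul_of_nonneg_left (hzx i) (hell i)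
  rcases min_le_iff.1 hwc with hA | hB
  · refine (min_le_left _ _).trans ?_
    calc m * excess h lam mu ell x
        ≤ ∑ i, ramp h (ell i * x i - lam i * ell i / mu i)
            * (ell i * x i - lam i * ell i / mu i) := by
          unfold excess
          rw [Finset.mul_sum]
          refine Finset.sum_le_sum fun i _ => le_trans ?_ (huber_le_ramp_mul hh _)
          rw [mul_div_assoc', div_le_iff₀ (hm.trans_le (hmu i)), mul_comm]
          exact mul_le_mul_of_nonneg_left (hmu i) (huber_nonneg hh _)
      -- As ramps are at most `1`, passing from `x` to `z` costs at most the unserved need, whose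
      -- total is nonpositive by `hA`.
      _ ≤ ∑ i, (ramp h (ell i * x i - lam i * ell i / mu i)
            * (ell i * z i - lam i * ell i / mu i) + (ell i * x i - ell i * z i)) := by
          refine Finset.sum_le_sum fun i _ => ?_
          nlinarith [ramp_le_one h (ell i * x i - lam i * ell i / mu i), hle i]
      _ ≤ _ := by
          rw [Finset.sum_add_distrib, Finset.sum_sub_distrib]
          linarith
  · refine (min_le_right _ _).trans ?_
    calc d - I * h ≤ ∑ i, ((ell i * z i - lam i * ell i / mu i) - h) := by
          rw [Finset.sum_sub_distrib, Finset.sum_sub_distrib]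
          simp only [Finset.sum_const, Finset.card_univ, Fintype.card_fin, nsmul_eq_mul]
          linarith
      _ ≤ _ := by
          -- Dropping the ramp loses `(1 - ramp)` times the served excess, which is at most `(1 -
          -- ramp)` times the full excess, hence at most `h`.
          refine Finset.sum_le_sum fun i _ => ?_
          have h1 := one_sub_ramp_mul_le hh (ell i * x i - lam i * ell i / mu i)
          nlinarith [ramp_le_one h (ell i * x i - lam i * ell i / mu i), hle i]

lemma le_excess {n w d : ℝ} (hh : 0 < h) (hm : 0 < m) (hmu : ∀ i, m ≤ mu i)
    (hL : ∀ i, mu i ≤ L) (hL0 : 0 < L)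
    (hd : d ≤ n - ∑ i, lam i * ell i / mu i - w) (hx : n - w ≤ ∑ i, ell i * x i) :
    (d - I * h / 2) / L ≤ excess h lam mu ell x := by
  rw [div_le_iff₀ hL0]
  calc d - I * h / 2 ≤ ∑ i, ((ell i * x i - lam i * ell i / mu i) - h / 2) := by
        rw [Finset.sum_sub_distrib, Finset.sum_sub_distrib]
        simp only [Finset.sum_const, Finset.card_univ, Fintype.card_fin, nsmul_eq_mul]
        linarith
    _ ≤ excess h lam mu ell x * L := by
        unfold excess
        rw [Finset.sum_mul]
        refine Finset.sum_le_sum fun i _ => ?_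
        have h1 := le_huber hh (ell i * x i - lam i * ell i / mu i) zero_le_one le_rfl
        have h2 := huber_nonneg hh (ell i * x i - lam i * ell i / mu i)
        have h3 := hm.trans_le (hmu i)
        rw [div_mul_eq_mul_div, le_div_iff₀ h3]
        nlinarith [hL i]

/-- The drift inequality for the exponential Lyapunov function. -/
lemma exp_excess_drift {n w d θ r c₀ : ℝ} (hh : 0 < h) (hm : 0 < m) (hmu : ∀ i, m ≤ mu i)
    (hlam : ∀ i, 0 ≤ lam i) (hell : ∀ i, 0 ≤ ell i) (hw0 : 0 ≤ w) (hw : ∀ i, ell i ≤ w)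
    (hz : ∀ i, 0 ≤ z i) (hzx : ∀ i, z i ≤ x i)
    (hd : d ≤ n - ∑ i, lam i * ell i / mu i - w)
    (hwc : min (∑ i, ell i * x i) (n - w) ≤ ∑ i, ell i * z i)
    (hload : ∑ i, lam i * ell i / mu i ≤ n) (hbusy : ∑ i, ell i * z i ≤ n)
    (hθ : 0 ≤ θ) (hw1 : θ * w / m ≤ 1) (hr : 0 ≤ r) (hrd : r ≤ d - I * h) (hrc : r ≤ m * c₀)
    (hsecond : (w / h + θ * (w / m)) * (2 * n) ≤ r / 2) :
    ∑ i, lam i * Real.exp (θ * excess h lam mu ell (Function.update x i (x i + 1)))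
      + ∑ i, mu i * z i * Real.exp (θ * excess h lam mu ell (Function.update x i (x i - 1)))
      + θ * r / 2 * Real.exp (θ * excess h lam mu ell x)
    ≤ (∑ i, lam i + ∑ i, mu i * z i) * Real.exp (θ * excess h lam mu ell x)
      + θ * r * Real.exp (θ * c₀) := by
  set V := Real.exp (θ * excess h lam mu ell x)
  have hV : 0 < V := Real.exp_pos _
  set g : Fin I → ℝ := fun i => ramp h (ell i * x i - lam i * ell i / mu i)
  set b := θ * (w / h) + θ ^ 2 * (w / m) with hb
  have hb0 : 0 ≤ b := by positivity
  have hpos : ∀ i, 0 < mu i := fun i => hm.trans_le (hmu i)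
  have hA : ∑ i, lam i * Real.exp (θ * excess h lam mu ell (Function.update x i (x i + 1)))
      ≤ ∑ i, (lam i * V + V * (θ * (g i * (lam i * ell i / mu i)) + b * (lam i * ell i / mu i))) := by
    refine Finset.sum_le_sum fun i _ => ?_
    have := exp_excess_update_le (lam := lam) (x := x) (a := x i + 1) hh hm hmu hell hθ hw hw1 i
      (by simp)
    refine (mul_le_mul_of_nonneg_left this (hlam i)).trans (le_of_eq ?_)
    simp only [g, V, hb]; ring
  have hB : ∑ i, mu i * z i * Real.exp (θ * excess h lam mu ell (Function.update x i (x i - 1)))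
      ≤ ∑ i, (mu i * z i * V + V * (b * (ell i * z i) - θ * (g i * (ell i * z i)))) := by
    refine Finset.sum_le_sum fun i _ => ?_
    have := exp_excess_update_le (lam := lam) (x := x) (a := x i - 1) hh hm hmu hell hθ hw hw1 i
      (by simp)
    refine (mul_le_mul_of_nonneg_left this (mul_nonneg (hpos i).le (hz i))).trans (le_of_eq ?_)
    have := (hpos i).ne'
    simp only [g, V, hb]; field_simp; ring
  have hg : min (m * excess h lam mu ell x) (d - I * h) ≤
      ∑ i, g i * (ell i * z i) - ∑ i, g i * (lam i * ell i / mu i) := by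
    refine (le_sum_ramp_mul hh hm hmu hell hzx hd hwc).trans (le_of_eq ?_)
    rw [← Finset.sum_sub_distrib]
    exact Finset.sum_congr rfl fun i _ => by simp only [g]; ring
  simp only [Finset.sum_add_distrib, Finset.sum_sub_distrib, ← Finset.mul_sum, ← Finset.sum_mul]
    at hA hB
  set S := ∑ i, g i * (ell i * z i) - ∑ i, g i * (lam i * ell i / mu i) with hS
  -- Multiplied by `ell i / mu i`, the jump rates sum to load plus busy servers, each at most `n`;
  -- hence the `2 * n`.
  have hsec : b * (∑ i, lam i * ell i / mu i + ∑ i, ell i * z i) ≤ θ * (r / 2) := by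
    calc b * (∑ i, lam i * ell i / mu i + ∑ i, ell i * z i) ≤ b * (2 * n) := by
          gcongr; linarith
      _ = θ * ((w / h + θ * (w / m)) * (2 * n)) := by rw [hb]; ring
      _ ≤ θ * (r / 2) := by gcongr
  have hmain : V * (θ * (r - S)) ≤ θ * r * Real.exp (θ * c₀) := by
    -- Above level `c₀` the first-order drift is at least `r` towards the origin; below it, the
    -- exponential is bounded and the drift still has the right sign.
    rcases le_total c₀ (excess h lam mu ell x) with hc | hc
    · have : r ≤ S := by
        refine le_trans (le_min ?_ hrd) hg
        exact hrc.trans (mul_le_mul_of_nonneg_left hc hm.le)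
      have h1 : V * (θ * (r - S)) ≤ 0 :=
        mul_nonpos_of_nonneg_of_nonpos hV.le
          (mul_nonpos_of_nonneg_of_nonpos hθ (by linarith))
      have : 0 ≤ θ * r * Real.exp (θ * c₀) := by positivity
      linarith
    · have hS0 : 0 ≤ S := by
        refine le_trans (le_min ?_ (hr.trans hrd)) hg
        exact mul_nonneg hm.le
          (Finset.sum_nonneg fun i _ => div_nonneg (huber_nonneg hh _) (hpos i).le)
      have hVle : V ≤ Real.exp (θ * c₀) :=
        Real.exp_le_exp.2 (mul_le_mul_of_nonneg_left hc hθ)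
      calc V * (θ * (r - S)) ≤ V * (θ * r) := by gcongr; linarith
        _ ≤ Real.exp (θ * c₀) * (θ * r) := by gcongr
        _ = _ := by ring
  have hVsec := mul_le_mul_of_nonneg_left hsec hV.le
  rw [hS] at hmain
  linarith

end Drift

/-! ### Moment bounds under a stationary law -/

lemma tsum_pmf_mul_eq {S : Type*} (p : PMF S) {f : S → ℝ≥0∞} {c : ℝ≥0∞}
    (hf : ∀ s ∈ p.support, f s = c) : ∑' s, p s * f s = c := by
  have : ∀ s, p s * f s = p s * c := fun s => by
    by_cases hs : s ∈ p.support
    · rw [hf s hs]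
    · rw [(p.apply_eq_zero_iff s).2 hs, zero_mul, zero_mul]
  simp_rw [this]
  rw [ENNReal.tsum_mul_right, p.tsum_coe, one_mul]

/-- A Foster–Lyapunov moment bound for a stationary distribution of a chain with bounded rates. -/
lemma mul_tsum_le_of_drift {S : Type*} (π : PMF S) (R : S → S → ℝ≥0∞)
    (hπ : ∀ s', ∑' s, π s * R s s' = π s' * ∑' s, R s' s) {Q : ℝ≥0∞} (hQ : Q ≠ ⊤)
    (hRQ : ∀ s, ∑' s', R s s' ≤ Q) (V : S → ℝ≥0∞) (hV : ∀ s, V s ≠ ⊤) {a b : ℝ≥0∞}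
    (hdrift : ∀ s, ∑' s', R s s' * V s' + a * V s ≤ (∑' s', R s s') * V s + b) :
    a * ∑' s, π s * V s ≤ b := by
  classical
  have trunc : ∀ M : ℝ≥0∞, M ≠ ⊤ → ∑' s, π s * (a * if V s < M then V s else 0) ≤ b := by
    intro M hM
    -- `V` need not be integrable a priori, so stationarity is applied to the truncation. Where `V ≥
    -- M` the truncation cannot drift upwards; elsewhere it inherits the drift of `V`.
    set f : S → ℝ≥0∞ := fun s => min (V s) M
    have hpt : ∀ s, ∑' s', R s s' * f s' + a * (if V s < M then V s else 0)
        ≤ (∑' s', R s s') * f s + b := by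
      intro s
      split_ifs with h
      · have h1 : f s = V s := min_eq_left h.le
        rw [h1]
        refine le_trans ?_ (hdrift s)
        gcongr
        exact min_le_left _ _
      · have h1 : f s = M := min_eq_right (not_lt.1 h)
        rw [h1, mul_zero, add_zero, ← ENNReal.tsum_mul_right]
        refine le_trans ?_ le_self_add
        gcongr
        exact min_le_right _ _
    have hbal : ∑' s, π s * ∑' s', R s s' * f s' = ∑' s, π s * ((∑' s', R s s') * f s) := by
      simp_rw [← ENNReal.tsum_mul_left]
      rw [ENNReal.tsum_comm]
      refine tsum_congr fun s' => ?_
      rw [← mul_assoc, ← hπ s', ← ENNReal.tsum_mul_right]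
      exact tsum_congr fun s => (mul_assoc _ _ _).symm
    -- Bounded rates and bounded `f` make the flow finite, so it can be cancelled in `ℝ≥0∞`.
    have hfin : ∑' s, π s * ((∑' s', R s s') * f s) ≠ ⊤ := by
      refine ne_top_of_le_ne_top (ENNReal.mul_ne_top hQ hM) ?_
      calc ∑' s, π s * ((∑' s', R s s') * f s) ≤ ∑' s, π s * (Q * M) := by
            gcongr with s
            · exact hRQ s
            · exact min_le_right _ _
        _ = Q * M := tsum_pmf_mul_eq π fun _ _ => rfl
    have hsum : ∑' s, π s * (∑' s', R s s' * f s' + a * (if V s < M then V s else 0))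
        ≤ ∑' s, π s * ((∑' s', R s s') * f s + b) := by
      exact ENNReal.tsum_le_tsum fun s => mul_le_mul' le_rfl (hpt s)
    simp_rw [mul_add] at hsum
    rw [ENNReal.tsum_add, ENNReal.tsum_add, hbal, tsum_pmf_mul_eq (c := b) π fun _ _ => rfl] at hsum
    exact (ENNReal.add_le_add_iff_left hfin).1 hsum
  rw [← ENNReal.tsum_mul_left, ENNReal.tsum_eq_iSup_sum]
  refine iSup_le fun F => ?_
  have hfin : ∑ s ∈ F, V s + 1 ≠ ⊤ :=
    ENNReal.add_ne_top.2 ⟨ENNReal.sum_ne_top.2 fun s _ => hV s, ENNReal.one_ne_top⟩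
  refine le_trans ?_ (trunc _ hfin)
  refine le_trans (Finset.sum_le_sum fun s hs => ?_) (ENNReal.sum_le_tsum F)
  have : V s < ∑ s ∈ F, V s + 1 :=
    (ENNReal.lt_add_right (hV s) one_ne_zero).trans_le
      (add_le_add (Finset.single_le_sum (f := V) (fun _ _ => zero_le) hs) le_rfl)
  rw [if_pos this]
  exact le_of_eq (by ring)

lemma mul_toOuterMeasure_le {S : Type*} (π : PMF S) (V : S → ℝ≥0∞) (A : Set S) {v : ℝ≥0∞}
    (hA : ∀ s ∈ A, v ≤ V s) : v * π.toOuterMeasure A ≤ ∑' s, π s * V s := by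
  rw [PMF.toOuterMeasure_apply, ← ENNReal.tsum_mul_left]
  refine ENNReal.tsum_le_tsum fun s => ?_
  by_cases hs : s ∈ A
  · rw [Set.indicator_of_mem hs, mul_comm]
    gcongr
    exact hA s hs
  · simp [hs]

/-! ### Job counts and the generator -/

section Jobs

variable {I n : ℕ} {ell : Fin I → ℕ}

lemma numInService_le (u : JobList I) (i : Fin I) : numInService u i ≤ numInSystem u i :=
  List.count_le_count_map (f := Prod.fst) (x := (i, true))

lemma numInSystem_of_types_append {u u' : JobList I} {i : Fin I} (h : types u' = types u ++ [i])
    (j : Fin I) : numInSystem u' j = numInSystem u j + if i = j then 1 else 0 := by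
  unfold numInSystem
  rw [h, List.count_append, List.count_singleton]
  simp

lemma numInSystem_of_types_eraseIdx {u u' : JobList I} {k : Fin u.length}
    (h : types u' = (types u).eraseIdx k) (j : Fin I) :
    numInSystem u j = numInSystem u' j + if (u.get k).1 = j then 1 else 0 := by
  unfold numInSystem
  have hk : (k : ℕ) < (types u).length := by simp [types]
  rw [h, ← (List.getElem_cons_eraseIdx_perm hk).count_eq, List.count_cons]
  simp [types]

lemma sum_in_service (u : JobList I) (f : Fin I → ℝ≥0∞) :
    ∑ k : Fin u.length, (if (u.get k).2 = true then f (u.get k).1 else 0)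
      = ∑ i, (numInService u i : ℝ≥0∞) * f i := by
  induction u with
  | nil => simp [numInService]
  | cons p u ih =>
    have h := Fin.sum_univ_succ (n := u.length)
      (fun k => if ((p :: u).get k).2 = true then f ((p :: u).get k).1 else 0)
    refine h.trans ?_
    simp only [List.get_cons_zero, List.get_cons_succ']
    rw [ih]
    obtain ⟨i, b⟩ := p
    cases b
    · simp [numInService]
    · have : ∀ j, (numInService ((i, true) :: u) j : ℝ≥0∞)
          = (if i = j then 1 else 0) + numInService u j := fun j => by
        unfold numInService
        rw [List.count_cons]
        by_cases hij : i = j <;> simp [hij, add_comm]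
      simp [this, add_mul, Finset.sum_add_distrib]

/-- If the newest job is queued, its servers are not among the busy ones. -/
lemma busyServers_add_le {u : JobList I} {i : Fin I} (h : u.getLast? = some (i, false)) :
    busyServers ell u + ell i ≤ totalNeed ell u := by
  obtain ⟨v, rfl⟩ := List.getLast?_eq_some_iff.1 h
  have h1 : ∀ j, ell j * numInService (v ++ [(i, false)]) j + (if i = j then ell j else 0)
      ≤ ell j * numInSystem (v ++ [(i, false)]) j := fun j => by
    have h2 : numInService (v ++ [(i, false)]) j = numInService v j := by
      simp [numInService, List.count_append]
    have h3 : numInSystem (v ++ [(i, false)]) j = numInSystem v j + if i = j then 1 else 0 :=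
      numInSystem_of_types_append (by simp [types]) j
    rw [h2, h3, mul_add]
    have := Nat.mul_le_mul_left (ell j) (numInService_le v j)
    split_ifs <;> simp <;> omega
  have h4 := Finset.sum_le_sum fun j (_ : j ∈ Finset.univ) => h1 j
  rw [Finset.sum_add_distrib] at h4
  simpa [busyServers, totalNeed] using h4

namespace Policy

/-- The numbers of jobs of each type in a state, as real numbers. -/
def counts (P : Policy I n ell) (s : P.State) : Fin I → ℝ := fun i => numInSystem (P.jobs s) i

lemma counts_arrive (P : Policy I n ell) {s s' : P.State} {i : Fin I}
    (h : s' ∈ (P.arrive s i).support) :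
    P.counts s' = Function.update (P.counts s) i (P.counts s i + 1) := by
  funext j
  have := numInSystem_of_types_append (P.arrive_types s i s' h) j
  by_cases hij : j = i
  · subst hij; simp [counts, this]
  · simp [counts, this, hij, Ne.symm hij]

lemma counts_complete (P : Policy I n ell) {s s' : P.State} {k : Fin (P.jobs s).length}
    (hk : ((P.jobs s).get k).2 = true) (h : s' ∈ (P.complete s k).support) :
    P.counts s' = Function.update (P.counts s) ((P.jobs s).get k).1
      (P.counts s ((P.jobs s).get k).1 - 1) := by
  funext j
  have := numInSystem_of_types_eraseIdx (P.complete_types s k hk s' h) j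
  by_cases hij : j = ((P.jobs s).get k).1
  · rw [if_pos hij.symm] at this
    rw [← hij]; simp [counts, this]
  · rw [if_neg (Ne.symm hij)] at this
    rw [Function.update_of_ne hij]; simp [counts, this]

lemma counts_review (P : Policy I n ell) {s s' : P.State} (h : s' ∈ (P.review s).support) :
    P.counts s' = P.counts s := by
  funext j
  simp [counts, numInSystem, P.review_types s s' h]

/-- The action of the transition rates on a function of the numbers of jobs. -/
lemma tsum_rate_mul (P : Policy I n ell) (lam mu : Fin I → ℝ≥0) (G : (Fin I → ℝ) → ℝ≥0∞)
    (s : P.State) :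
    ∑' s', P.rate lam mu s s' * G (P.counts s')
      = ∑ i, (lam i : ℝ≥0∞) * G (Function.update (P.counts s) i (P.counts s i + 1))
        + ∑ i, (numInService (P.jobs s) i : ℝ≥0∞) *
          ((mu i : ℝ≥0∞) * G (Function.update (P.counts s) i (P.counts s i - 1)))
        + (P.clock : ℝ≥0∞) * G (P.counts s) := by
  simp only [rate, add_mul, Finset.sum_mul]
  rw [ENNReal.tsum_add, ENNReal.tsum_add, Summable.tsum_finsetSum fun _ _ => ENNReal.summable,
    Summable.tsum_finsetSum fun _ _ => ENNReal.summable, ← sum_in_service]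
  congr 1
  · congr 1
    · refine Finset.sum_congr rfl fun i _ => ?_
      simp_rw [mul_assoc]
      rw [ENNReal.tsum_mul_left, tsum_pmf_mul_eq _ fun s' h => by rw [P.counts_arrive h]]
    · refine Finset.sum_congr rfl fun k _ => ?_
      split_ifs with hk
      · simp_rw [mul_assoc]
        rw [ENNReal.tsum_mul_left, tsum_pmf_mul_eq _ fun s' h => by rw [P.counts_complete hk h]]
      · simp
  · simp_rw [mul_assoc]
    rw [ENNReal.tsum_mul_left, tsum_pmf_mul_eq _ fun s' h => by rw [P.counts_review h]]

lemma tsum_rate (P : Policy I n ell) (lam mu : Fin I → ℝ≥0) (s : P.State) :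
    ∑' s', P.rate lam mu s s'
      = ∑ i, (lam i : ℝ≥0∞) + ∑ i, (numInService (P.jobs s) i : ℝ≥0∞) * (mu i : ℝ≥0∞)
        + (P.clock : ℝ≥0∞) := by
  simpa using P.tsum_rate_mul lam mu (fun _ => 1) s

lemma numInService_le_servers (P : Policy I n ell) (hell : ∀ i, 1 ≤ ell i) (s : P.State)
    (i : Fin I) : numInService (P.jobs s) i ≤ n := by
  refine le_trans ?_ (P.feasible s)
  calc numInService (P.jobs s) i ≤ ell i * numInService (P.jobs s) i :=
        Nat.le_mul_of_pos_left _ (hell i)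
    _ ≤ _ := Finset.single_le_sum (f := fun i => ell i * numInService (P.jobs s) i)
        (fun _ _ => Nat.zero_le _) (Finset.mem_univ i)

lemma tsum_rate_le (P : Policy I n ell) (lam mu : Fin I → ℝ≥0) (hell : ∀ i, 1 ≤ ell i)
    (s : P.State) :
    ∑' s', P.rate lam mu s s'
      ≤ ∑ i, (lam i : ℝ≥0∞) + ∑ i, (n : ℝ≥0∞) * (mu i : ℝ≥0∞) + (P.clock : ℝ≥0∞) := by
  rw [tsum_rate]
  gcongr with i
  exact_mod_cast P.numInService_le_servers hell s i

/-- A queued newcomer leaves the busy servers after the arrival at most the need before it. That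
excludes full service, so work conservation makes at least `n - w` servers busy, and the need before
the arrival, whose law is `π`, was already at least `n - w`. -/
lemma queueingProb_le (P : Policy I n ell) (lam : Fin I → ℝ≥0) (π : PMF P.State) {w : ℝ}
    (hell : ∀ i, 1 ≤ ell i) (hP : P.IsWorkConserving w) :
    P.queueingProb lam π ≤ π.toOuterMeasure {s | (n : ℝ) - w ≤ totalNeed ell (P.jobs s)} := by
  set A := {s | (n : ℝ) - w ≤ totalNeed ell (P.jobs s)}
  have key : ∀ i, (π.bind fun s => P.arrive s i).toOuterMeasure {s' | NewestIsQueued (P.jobs s')}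
      ≤ π.toOuterMeasure A := by
    intro i
    rw [PMF.toOuterMeasure_bind_apply, PMF.toOuterMeasure_apply]
    refine ENNReal.tsum_le_tsum fun s => ?_
    by_cases hs : s ∈ A
    · rw [Set.indicator_of_mem hs]
      refine mul_le_of_le_one_right zero_le ?_
      rw [← (PMF.toOuterMeasure_apply_eq_one_iff (P.arrive s i) (s := Set.univ)).2
        (Set.subset_univ _)]
      exact MeasureTheory.measure_mono (Set.subset_univ _)
    · rw [Set.indicator_of_notMem hs, nonpos_iff_eq_zero, mul_eq_zero]
      right
      rw [PMF.toOuterMeasure_apply_eq_zero_iff, Set.disjoint_left]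
      rintro s' hs' ⟨j, hj⟩
      apply hs
      have htypes := P.arrive_types s i s' hs'
      have hij : j = i := by
        obtain ⟨v, hv⟩ := List.getLast?_eq_some_iff.1 hj
        rw [hv] at htypes
        have := congrArg List.getLast? htypes
        simpa [types] using this
      subst hij
      have hbusy := busyServers_add_le (ell := ell) hj
      have htotal : totalNeed ell (P.jobs s') = totalNeed ell (P.jobs s) + ell j := by
        simp [totalNeed, numInSystem_of_types_append htypes, mul_add, Finset.sum_add_distrib]
      have hb : (busyServers ell (P.jobs s') : ℝ) ≤ totalNeed ell (P.jobs s) := by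
        exact_mod_cast (by omega : busyServers ell (P.jobs s') ≤ totalNeed ell (P.jobs s))
      have h1 : (1 : ℝ) ≤ ell j := by exact_mod_cast hell j
      rcases min_le_iff.1 (hP s') with h | h
      · rw [htotal] at h
        push_cast at h
        linarith
      · exact h.trans hb
  calc P.queueingProb lam π
      ≤ ∑ i, ((lam i : ℝ≥0∞) / ∑ j, (lam j : ℝ≥0∞)) * π.toOuterMeasure A := by
        unfold queueingProb
        exact Finset.sum_le_sum fun i _ => mul_le_mul' le_rfl (key i)
    _ = ((∑ i, (lam i : ℝ≥0∞)) / ∑ j, (lam j : ℝ≥0∞)) * π.toOuterMeasure A := by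
        rw [← Finset.sum_mul]; simp only [div_eq_mul_inv, Finset.sum_mul]
    _ ≤ _ := mul_le_of_le_one_left zero_le ENNReal.div_self_le_one

/-- Markov's inequality for the exponential moment; the prefactor `2` is the ratio of `θ * r` to `θ
* r / 2` in the drift inequality. -/
lemma toOuterMeasure_le_exp (P : Policy I n ell) (lam mu : Fin I → ℝ≥0) (π : PMF P.State)
    (hπ : P.IsStationary lam mu π) {w h m L d θ r c₀ : ℝ} (hell : ∀ i, 1 ≤ ell i)
    (hP : P.IsWorkConserving w) (hw0 : 0 ≤ w) (hw : ∀ i, (ell i : ℝ) ≤ w)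
    (hh : 0 < h) (hm : 0 < m) (hmu : ∀ i, m ≤ mu i) (hL : ∀ i, (mu i : ℝ) ≤ L) (hL0 : 0 < L)
    (hd : d ≤ slack n lam mu ell - w) (hslack : 0 ≤ slack n lam mu ell)
    (hθ : 0 < θ) (hw1 : θ * w / m ≤ 1) (hr : 0 < r) (hrd : r ≤ d - I * h) (hrc : r ≤ m * c₀)
    (hsecond : (w / h + θ * (w / m)) * (2 * n) ≤ r / 2) :
    π.toOuterMeasure {s | (n : ℝ) - w ≤ totalNeed ell (P.jobs s)}
      ≤ ENNReal.ofReal (2 * Real.exp (θ * (c₀ - (d - I * h / 2) / L))) := by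
  set lam' : Fin I → ℝ := fun i => lam i with hlam'
  set mu' : Fin I → ℝ := fun i => mu i with hmu'
  set ell' : Fin I → ℝ := fun i => ell i with hell'
  set G : (Fin I → ℝ) → ℝ := fun x => Real.exp (θ * excess h lam' mu' ell' x) with hG
  have hG0 : ∀ x, 0 ≤ G x := fun x => (Real.exp_pos _).le
  have hneed : ∀ s, (totalNeed ell (P.jobs s) : ℝ) = ∑ i, ell' i * P.counts s i := fun s => by
    simp [totalNeed, counts, hell']
  have hbusy : ∀ s, (busyServers ell (P.jobs s) : ℝ)
      = ∑ i, ell' i * (numInService (P.jobs s) i : ℝ) := fun s => by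
    simp [busyServers, hell']
  have hdrift : ∀ s, ∑' s', P.rate lam mu s s' * ENNReal.ofReal (G (P.counts s'))
        + ENNReal.ofReal (θ * r / 2) * ENNReal.ofReal (G (P.counts s))
      ≤ (∑' s', P.rate lam mu s s') * ENNReal.ofReal (G (P.counts s))
        + ENNReal.ofReal (θ * r * Real.exp (θ * c₀)) := by
    intro s
    have hreal := exp_excess_drift (lam := lam') (mu := mu') (ell := ell') (x := P.counts s)
      (z := fun i => (numInService (P.jobs s) i : ℝ)) (n := n) (θ := θ) hh hm hmu
      (fun i => (lam i).coe_nonneg) (fun i => Nat.cast_nonneg _) hw0 hw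
      (fun i => Nat.cast_nonneg _) (fun i => Nat.cast_le.2 (numInService_le _ i)) hd
      (by rw [← hneed, ← hbusy]; exact hP s) (by unfold slack at hslack; linarith)
      (by rw [← hbusy]; exact_mod_cast P.feasible s) hθ.le hw1 hr.le hrd hrc hsecond
    have hreal := ENNReal.ofReal_le_ofReal hreal
    rw [P.tsum_rate_mul lam mu (fun x => ENNReal.ofReal (G x)), P.tsum_rate]
    rw [ENNReal.ofReal_add (by positivity) (by positivity),
      ENNReal.ofReal_add (by positivity) (by positivity),
      ENNReal.ofReal_add (by positivity) (by positivity), ENNReal.ofReal_mul (by positivity),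
      ENNReal.ofReal_mul (p := _ + _) (by positivity),
      ENNReal.ofReal_add (by positivity) (by positivity),
      ENNReal.ofReal_sum_of_nonneg (fun i _ => by positivity),
      ENNReal.ofReal_sum_of_nonneg (fun i _ => by positivity),
      ENNReal.ofReal_sum_of_nonneg (fun i _ => by positivity),
      ENNReal.ofReal_sum_of_nonneg (fun i _ => by positivity)] at hreal
    have e1 : ∀ i (t : ℝ), ENNReal.ofReal (lam' i * t) = (lam i : ℝ≥0∞) * ENNReal.ofReal t :=
      fun i t => by rw [ENNReal.ofReal_mul (lam i).coe_nonneg, ENNReal.ofReal_coe_nnreal]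
    have e2 : ∀ i, ENNReal.ofReal (mu' i * numInService (P.jobs s) i)
        = (numInService (P.jobs s) i : ℝ≥0∞) * (mu i : ℝ≥0∞) :=
      fun i => by
        rw [ENNReal.ofReal_mul (mu i).coe_nonneg, ENNReal.ofReal_coe_nnreal,
          ENNReal.ofReal_natCast, mul_comm]
    have e3 : ∀ i (t : ℝ), ENNReal.ofReal (mu' i * numInService (P.jobs s) i * t)
        = (numInService (P.jobs s) i : ℝ≥0∞) * ((mu i : ℝ≥0∞) * ENNReal.ofReal t) :=
      fun i t => by rw [ENNReal.ofReal_mul (by positivity), e2, mul_assoc]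
    have e4 : ∀ i, ENNReal.ofReal (lam' i) = (lam i : ℝ≥0∞) :=
      fun i => ENNReal.ofReal_coe_nnreal
    simp only [e1, e2, e3, e4] at hreal
    -- Ticks of the policy's clock leave the counts fixed and add the same term to both sides.
    have h2 := add_le_add hreal (le_refl ((P.clock : ℝ≥0∞) * ENNReal.ofReal (G (P.counts s))))
    refine le_trans (le_of_eq ?_) (h2.trans (le_of_eq ?_))
    · simp only [hG]; ring
    · simp only [hG]; ring
  have hmoment := mul_tsum_le_of_drift π (P.rate lam mu) hπ
    (Q := ∑ i, (lam i : ℝ≥0∞) + ∑ i, (n : ℝ≥0∞) * (mu i : ℝ≥0∞) + (P.clock : ℝ≥0∞))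
    (by simp [ENNReal.mul_eq_top, ENNReal.sum_eq_top]) (P.tsum_rate_le lam mu hell)
    (fun s => ENNReal.ofReal (G (P.counts s))) (fun s => ENNReal.ofReal_ne_top) hdrift
  have hmarkov := mul_toOuterMeasure_le π (fun s => ENNReal.ofReal (G (P.counts s)))
    {s | (n : ℝ) - w ≤ totalNeed ell (P.jobs s)}
    (v := ENNReal.ofReal (Real.exp (θ * ((d - I * h / 2) / L)))) (fun s hs => by
      refine ENNReal.ofReal_le_ofReal (Real.exp_le_exp.2 (mul_le_mul_of_nonneg_left ?_ hθ.le))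
      refine le_excess (n := n) (w := w) hh hm hmu hL hL0 hd ?_
      rw [← hneed]; exact hs)
  have hab := (mul_le_mul' (le_refl (ENNReal.ofReal (θ * r / 2))) hmarkov).trans hmoment
  rw [← mul_assoc, ← ENNReal.ofReal_mul (by positivity), mul_comm,
    ← ENNReal.le_div_iff_mul_le (.inl (by simp; positivity)) (.inl ENNReal.ofReal_ne_top),
    ← ENNReal.ofReal_div_of_pos (by positivity)] at hab
  refine hab.trans (ENNReal.ofReal_le_ofReal (le_of_eq ?_))
  rw [mul_sub, Real.exp_sub]
  field_simp

/-- The tail bound with explicit constants, for a fixed number of servers. -/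
lemma toOuterMeasure_le_exp_slack (P : Policy I n ell) (lam mu : Fin I → ℝ≥0) (π : PMF P.State)
    (hπ : P.IsStationary lam mu π) {w m L ε : ℝ} (hI : 0 < I) (hn : 0 < n) (hell : ∀ i, 1 ≤ ell i)
    (hP : P.IsWorkConserving w) (hw0 : 0 < w) (hw : ∀ i, (ell i : ℝ) ≤ w)
    (hm : 0 < m) (hmu : ∀ i, m ≤ mu i) (hL : ∀ i, (mu i : ℝ) ≤ L) (hmL : m ≤ L)
    (hε0 : 0 < ε) (hε1 : ε ≤ 1) (hslack : 0 < slack n lam mu ell)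
    (hwε : w ≤ (1 - ε) * slack n lam mu ell)
    (hsmall : n * w ≤ ε ^ 2 * m / (64 * I * L) * slack n lam mu ell ^ 2)
    (hsmall' : n * w ≤ m ^ 2 * ε ^ 2 / (128 * L ^ 2) * slack n lam mu ell ^ 2) :
    π.toOuterMeasure {s | (n : ℝ) - w ≤ totalNeed ell (P.jobs s)}
      ≤ ENNReal.ofReal (Real.exp
        (-(m ^ 2 * ε ^ 2 / (128 * L ^ 2) * (slack n lam mu ell ^ 2 / (n * w))))) := by
  set D := slack n lam mu ell with hD
  have hDn : D ≤ n := by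
    rw [hD, slack, sub_le_self_iff]
    exact Finset.sum_nonneg fun i _ => by positivity
  have hn' : (0 : ℝ) < n := by exact_mod_cast hn
  have hI' : (0 : ℝ) < I := by exact_mod_cast hI
  have hL0 : 0 < L := hm.trans_le hmL
  -- `w ≤ (1 - ε) * D` leaves `D - w ≥ d`. Then `h` makes `I * h = d / 2`, and `r = m * c₀` with `c₀
  -- = d / (4 * L)` stays below the remaining margin.
  set d := ε * D with hd_def
  have hd0 : 0 < d := by positivity
  have hdn : d ≤ n := (mul_le_of_le_one_left hslack.le hε1).trans hDn
  set h := d / (2 * I) with hh_def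
  have hIh : I * h = d / 2 := by rw [hh_def]; field_simp
  set r := m * (d / (4 * L)) with hr_def
  have hrd : r ≤ d / 4 := by
    rw [hr_def, mul_div_assoc', div_le_div_iff₀ (by positivity) (by positivity)]
    nlinarith
  -- Makes the `θ` part of the second-order term exactly `r / 4`; `hsmall` bounds the `w / h` part
  -- by another `r / 4`.
  set θ := r * m / (8 * (n * w)) with hθ_def
  have h0 := P.toOuterMeasure_le_exp lam mu π hπ (h := h) (m := m) (L := L) (d := d) (θ := θ)
    (r := r) (c₀ := d / (4 * L)) hell hP hw0.le hw (by positivity) hm hmu hL hL0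
    (by rw [← hD, hd_def]; linarith) hslack.le (by positivity)
    (by
      have : θ * w / m = r / (8 * n) := by rw [hθ_def]; field_simp
      rw [this, div_le_one (by positivity)]; linarith)
    (by positivity) (by rw [hIh]; linarith) le_rfl
    (by
      have h1 : θ * (w / m) * (2 * n) = r / 4 := by rw [hθ_def]; field_simp; ring
      have h2 : w / h * (2 * n) ≤ r / 4 := by
        rw [div_mul_eq_mul_div, div_le_iff₀ (by positivity)]
        have : r / 4 * h = 2 * (ε ^ 2 * m / (64 * I * L) * D ^ 2) := by
          rw [hr_def, hh_def, hd_def]; field_simp; ring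
        rw [this]; linarith
      rw [add_mul, h1]; linarith)
  refine h0.trans (ENNReal.ofReal_le_ofReal ?_)
  set c := m ^ 2 * ε ^ 2 / (128 * L ^ 2) with hc
  -- On the event `excess` is at least `3 * d / (4 * L)`, a gap of `d / (2 * L)` above `c₀`. This
  -- yields twice the claimed exponent, and the spare half absorbs the factor `2`.
  have hexp : θ * (d / (4 * L) - (d - I * h / 2) / L) = -(2 * (c * (D ^ 2 / (n * w)))) := by
    rw [hIh, hθ_def, hr_def, hd_def, hc]; field_simp; ring
  have h1 : 1 ≤ c * (D ^ 2 / (n * w)) := by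
    rw [mul_div_assoc', one_le_div (by positivity)]; exact hsmall'
  rw [hexp]
  calc 2 * Real.exp (-(2 * (c * (D ^ 2 / (n * w)))))
      ≤ Real.exp (c * (D ^ 2 / (n * w))) * Real.exp (-(2 * (c * (D ^ 2 / (n * w))))) := by
        gcongr
        linarith [Real.add_one_le_exp (c * (D ^ 2 / (n * w)))]
    _ = _ := by rw [← Real.exp_add]; ring_nf

end Policy

end Jobs

end MSJ

/-! ### Passage to large `n` -/

theorem corollary2 (I : ℕ) (mu : Fin I → ℝ≥0) (hmu : ∀ i, 0 < mu i)
    (ε₀ : ℝ) (hε₀ : 0 < ε₀) (hε₁ : ε₀ < 1) :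
    ∃ c : ℝ, 0 < c ∧
      ∀ (lam : ℕ → Fin I → ℝ≥0) (ell : ℕ → Fin I → ℕ),
        (∀ n i, 1 ≤ ell n i) →
        (∀ᶠ n : ℕ in atTop,
          (MSJ.maxNeed (ell n) : ℝ) ≤ ε₀ * MSJ.slack n (lam n) mu (ell n)) →
        ((fun n : ℕ => Real.sqrt ((n : ℝ) * (MSJ.maxNeed (ell n) : ℝ)) * Real.log (n : ℝ))
          =o[atTop] fun n : ℕ => MSJ.slack n (lam n) mu (ell n)) →
        ∀ᶠ n : ℕ in atTop,
          ∀ P : MSJ.Policy I n (ell n),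
            P.IsWorkConserving (MSJ.maxNeed (ell n) : ℝ) →
            ∀ π : PMF P.State, P.IsStationary (lam n) mu π →
              P.probNeedGe π ≤ ENNReal.ofReal (Real.exp
                (-(c * ((MSJ.slack n (lam n) mu (ell n)) ^ 2
                  / ((n : ℝ) * (MSJ.maxNeed (ell n) : ℝ)))))) ∧
              P.queueingProb (lam n) π ≤ ENNReal.ofReal (Real.exp
                (-(c * ((MSJ.slack n (lam n) mu (ell n)) ^ 2
                  / ((n : ℝ) * (MSJ.maxNeed (ell n) : ℝ)))))) := by
  rcases Nat.eq_zero_or_pos I with rfl | hI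
  -- Without job types `maxNeed` is `0`, division by zero gives `0`, and the bound is the trivial
  -- `exp 0 = 1`.
  · refine ⟨1, one_pos, fun lam ell _ _ _ => Eventually.of_forall fun n P _ π _ => ?_⟩
    have hmax : MSJ.maxNeed (ell n) = 0 := by simp [MSJ.maxNeed]
    rw [hmax]
    simp only [Nat.cast_zero, mul_zero, div_zero, neg_zero, Real.exp_zero, ENNReal.ofReal_one]
    refine ⟨?_, by simp [MSJ.Policy.queueingProb]⟩
    unfold MSJ.Policy.probNeedGe
    rw [← (PMF.toOuterMeasure_apply_eq_one_iff π (s := Set.univ)).2 (Set.subset_univ _)]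
    exact MeasureTheory.measure_mono (Set.subset_univ _)
  have hne : (Finset.univ : Finset (Fin I)).Nonempty := ⟨⟨0, hI⟩, Finset.mem_univ _⟩
  obtain ⟨i₀, -, hmin⟩ := Finset.exists_min_image Finset.univ (fun i => (mu i : ℝ)) hne
  obtain ⟨i₁, -, hmax⟩ := Finset.exists_max_image Finset.univ (fun i => (mu i : ℝ)) hne
  set m : ℝ := (mu i₀ : ℝ)
  set L : ℝ := (mu i₁ : ℝ)
  have hm : 0 < m := hmu i₀
  have hL : 0 < L := hmu i₁
  have hI' : (0 : ℝ) < I := by exact_mod_cast hI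
  set ε : ℝ := 1 - ε₀ with hε
  have hε0 : 0 < ε := by linarith
  set c := m ^ 2 * ε ^ 2 / (128 * L ^ 2) with hc
  set c' := ε ^ 2 * m / (64 * I * L) with hc'
  have hc0 : 0 < c := by positivity
  have hc'0 : 0 < c' := by positivity
  refine ⟨c, hc0, fun lam ell hell hmaxle hlittle => ?_⟩
  filter_upwards [hmaxle, hlittle.def (Real.sqrt_pos.2 (lt_min hc0 hc'0)), eventually_ge_atTop 3]
    with n hn1 hn2 hn3 P hP π hπ
  set w : ℝ := (MSJ.maxNeed (ell n) : ℝ) with hw_def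
  set D := MSJ.slack n (lam n) mu (ell n) with hD
  have hlew : ∀ i, (ell n i : ℝ) ≤ w := fun i =>
    Nat.cast_le.2 (Finset.le_sup (f := ell n) (Finset.mem_univ i))
  have hw0 : 0 < w := lt_of_lt_of_le (by exact_mod_cast hell n i₀) (hlew i₀)
  have hD0 : 0 < D := pos_of_mul_pos_right (hw0.trans_le hn1) hε₀.le
  -- Since `n ≥ 3 > e`, the logarithm can be dropped, leaving `n * w` at most a small multiple of `D
  -- ^ 2`.
  have hlog : 1 ≤ Real.log n := by
    rw [Real.le_log_iff_exp_le (by positivity)]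
    have : (3 : ℝ) ≤ n := by exact_mod_cast hn3
    linarith [Real.exp_one_lt_d9]
  have hsq : n * w ≤ min c c' * D ^ 2 := by
    rw [Real.norm_of_nonneg (by positivity), Real.norm_of_nonneg hD0.le] at hn2
    have h1 : Real.sqrt (n * w) ≤ Real.sqrt (min c c') * D :=
      (le_mul_of_one_le_right (Real.sqrt_nonneg _) hlog).trans hn2
    have h2 := pow_le_pow_left₀ (Real.sqrt_nonneg _) h1 2
    rwa [mul_pow, Real.sq_sqrt (by positivity), Real.sq_sqrt (by positivity)] at h2
  have key := P.toOuterMeasure_le_exp_slack (lam n) mu π hπ (ε := ε) hI (by omega) (hell n) hP hw0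
    hlew hm (fun i => hmin i (Finset.mem_univ i)) (fun i => hmax i (Finset.mem_univ i))
    (hmin i₁ (Finset.mem_univ i₁)) hε0 (by linarith) hD0
    (by rw [hε, sub_sub_cancel]; exact hn1)
    (hsq.trans (mul_le_mul_of_nonneg_right (min_le_right _ _) (sq_nonneg D)))
    (hsq.trans (mul_le_mul_of_nonneg_right (min_le_left _ _) (sq_nonneg D)))
  refine ⟨le_trans (MeasureTheory.measure_mono fun s hs => ?_) key,
    (P.queueingProb_le (lam n) π (hell n) hP).trans key⟩
  have hs' : (n : ℝ) ≤ MSJ.totalNeed (ell n) (P.jobs s) := by exact_mod_cast hs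
  change (n : ℝ) - w ≤ _
  linarith
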